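/- Let $N\ge 1$ be an integer and $1\le p<N$, and put $p^\ast=\frac{Np}{N-p}$. Let $\dot W^{1,p}(\mathbb R^N)$ be the closure of $C_0^\infty(\mathbb R^N)$ (real-valued functions) with respect to the norm $\|\nabla u\|_{L^p}$, realized as a space of functions: a locally integrable $u:\mathbb R^N\to\mathbb R$ belongs to it if it has a weak gradient $\nabla u\in L^p$ and there are $\varphi_n\in C_0^\infty(\mathbb R^N)$ with $\nabla\varphi_n\to\nabla u$ in $L^p$ and $\varphi_n\to u$ in $L^1_{\mathrm{loc}}$. For $1\le r<\infty$ and $0\le\gamma\le N$, let $\mathcal L^{r,\gamma}(\mathbb R^N)$ be the homogeneous Morrey space of measurable functions $u$ with $$\|u\|_{\mathcal L^{r,\gamma}}:=\Big(\sup_{x\in\mathbb R^N,\;R>0} R^{\gamma}\,\frac1{|B_R(x)|}\int_{B_R(x)}|u|^r\,dy\Big)^{1/r}<\infty ,$$ where $B_R(x)$ is the open ball of radius $R$ about $x$. Then there is a constant $C$ depending only on $N$ and $p$ such that, for every $\theta$ with $p/p^\ast\le\theta<1$, every $r$ with $1\le r<p^\ast$, and every $u\in\dot W^{1,p}(\mathbb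 R^N)$, one has $u\in L^{p^\ast}(\mathbb R^N)\cap\mathcal L^{r,\,r(N-p)/p}(\mathbb R^N)$ and $$\|u\|_{L^{p^\ast}}\le C\,\|\nabla u\|_{L^p}^{\theta}\,\|u\|_{\mathcal L^{r,\,r(N-p)/p}}^{1-\theta}.$$ -/

import Mathlib

open MeasureTheory Filter Topology
open scoped ENNReal NNReal ContDiff

noncomputable section

/-- The critical Sobolev exponent `p* = N p / (N - p)`. -/
def sobolevExponent (N : ℕ) (p : ℝ) : ℝ := N * p / (N - p)

/-- A test function on `ℝ^N`: a real-valued smooth function with compact support. -/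
def IsTestFunction {N : ℕ} (φ : EuclideanSpace ℝ (Fin N) → ℝ) : Prop :=
  ContDiff ℝ ∞ φ ∧ HasCompactSupport φ

/-- `g` is the weak (distributional) gradient of `u`:
`∫ u ∂ᵢφ = - ∫ gᵢ φ` for all test functions `φ` and all `i`. -/
def HasWeakGradient {N : ℕ} (u : EuclideanSpace ℝ (Fin N) → ℝ)
    (g : EuclideanSpace ℝ (Fin N) → EuclideanSpace ℝ (Fin N)) : Prop :=
  LocallyIntegrable u volume ∧ LocallyIntegrable g volume ∧
    ∀ φ : EuclideanSpace ℝ (Fin N) → ℝ, IsTestFunction φ → ∀ i : Fin N,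
      ∫ x, u x * gradient φ x i = - ∫ x, g x i * φ x

/-- `u` belongs to the homogeneous Sobolev space `Ẇ^{1,p}(ℝ^N)` and `∇u = g`.
The space is the closure of the test functions with respect to the `L^p` norm of the gradient,
realized as a space of (classes of) locally integrable functions: `g` is the weak gradient of `u`,
it lies in `L^p`, and there are test functions `φₙ` with `∇φₙ → g` in `L^p` and
`φₙ → u` in `L¹` on every compact set. The last condition excludes the nonzero constants,
which the seminorm `‖∇u‖_{L^p}` does not see. -/
structure MemHomogeneousSobolev {N : ℕ} (p : ℝ) (u : EuclideanSpace ℝ (Fin N) → ℝ)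
    (g : EuclideanSpace ℝ (Fin N) → EuclideanSpace ℝ (Fin N)) : Prop where
  hasWeakGradient : HasWeakGradient u g
  memLp : MemLp g (ENNReal.ofReal p) volume
  exists_approx : ∃ φ : ℕ → EuclideanSpace ℝ (Fin N) → ℝ,
    (∀ n, IsTestFunction (φ n)) ∧
    Tendsto (fun n => eLpNorm (fun x => gradient (φ n) x - g x) (ENNReal.ofReal p) volume)
      atTop (𝓝 0) ∧
    ∀ K : Set (EuclideanSpace ℝ (Fin N)), IsCompact K →
      Tendsto (fun n => eLpNorm (fun x => φ n x - u x) 1 (volume.restrict K)) atTop (𝓝 0)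

/-- The norm of the homogeneous Morrey space `𝓛^{r,γ}(ℝ^N)`, with values in `[0, ∞]`:
`(sup_{x, R > 0} R^γ ⨍_{B_R(x)} |u|^r)^{1/r}`. -/
def morreyNorm {N : ℕ} (r γ : ℝ) (u : EuclideanSpace ℝ (Fin N) → ℝ) : ℝ≥0∞ :=
  (⨆ (x : EuclideanSpace ℝ (Fin N)) (R : ℝ) (_ : 0 < R),
    ENNReal.ofReal (R ^ γ) * ⨍⁻ y in Metric.ball x R, ‖u y‖ₑ ^ r ∂volume) ^ (1 / r)

/-- Membership in the Morrey space `𝓛^{r,γ}(ℝ^N)`. -/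
def MemMorrey {N : ℕ} (r γ : ℝ) (u : EuclideanSpace ℝ (Fin N) → ℝ) : Prop :=
  AEStronglyMeasurable u volume ∧ morreyNorm r γ u < ⊤

end

/-! Write α = (N-p)/p, q = p* = p + p/α, and let m bound the Morrey norm of φ with r = 1. At height
a, take R with R^α = 2m/a, so that every mean of |φ| over a ball of radius R is at most a/2. A
smooth truncation v of φ to the layer a ≤ |φ| < 2a equals a where |φ| ≥ 2a and satisfies |v| ≤ |φ|;
hence at such points v differs from its translates by at least a/2 on average over |h| < R. Since
‖v(·+h) - v‖_p ≤ |h| ‖∇v‖_p, the set {|φ| ≥ 2a} has measure at most a constant times (R/a)^p times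
the energy of φ in the layer (`rpow_mul_measure_le_setLIntegral_fderiv`). As R^p is comparable to
(m/a)^(p/α), the weight a^q appears. The layers for a = 2^k are disjoint, so summing gives ∫|φ|^q ≲
m^(p/α) ∫|∇φ|^p (`lintegral_rpow_le_of_morrey_bound`), which is the case θ = p/q, r = 1.

The classical Sobolev inequality makes the approximating test functions converge in L^q, hence in
the Morrey norm, and the estimate passes to the limit (`exists_improved_sobolev_const`). Jensen's
inequality on balls gives larger r; larger θ follows from bounding part of the Morrey factor by
‖∇u‖_p. -/

/-- Jensen's inequality for the power `t ↦ t ^ p` on a probability space. -/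
theorem lintegral_enorm_rpow_le_of_isProbabilityMeasure {Ω F : Type*} [MeasurableSpace Ω]
    [NormedAddCommGroup F] {ν : Measure Ω} [IsProbabilityMeasure ν] {f : Ω → F}
    (hf : AEStronglyMeasurable f ν) {p : ℝ} (hp : 1 ≤ p) :
    (∫⁻ x, ‖f x‖ₑ ∂ν) ^ p ≤ ∫⁻ x, ‖f x‖ₑ ^ p ∂ν := by
  have h := eLpNorm'_le_eLpNorm'_of_exponent_le one_pos hp ν hf
  have hp0 : 0 < p := by linarith
  simp only [eLpNorm', ENNReal.rpow_one, div_one] at h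
  calc (∫⁻ x, ‖f x‖ₑ ∂ν) ^ p ≤ ((∫⁻ x, ‖f x‖ₑ ^ p ∂ν) ^ (1 / p)) ^ p := by gcongr
    _ = _ := by rw [← ENNReal.rpow_mul, one_div_mul_cancel hp0.ne', ENNReal.rpow_one]

/-! ### Translation differences and the gradient -/

section Translation

variable {E : Type*} [NormedAddCommGroup E] [NormedSpace ℝ E]

theorem enorm_translate_sub_le {v : E → ℝ} (hv : ContDiff ℝ 1 v) (x h : E) :
    ‖v (x + h) - v x‖ₑ ≤ ∫⁻ t in Set.Icc (0 : ℝ) 1, ‖‖fderiv ℝ v (x + t • h)‖ * ‖h‖‖ₑ := by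
  have hline : ContDiff ℝ 1 (fun t : ℝ => x + t • h) := by fun_prop
  have h1 := enorm_sub_le_lintegral_deriv_of_contDiffOn_Icc
    (hv.comp hline).contDiffOn (zero_le_one' ℝ)
  simp only [Function.comp_apply, one_smul, zero_smul, add_zero] at h1
  refine h1.trans (lintegral_mono fun t => ?_)
  have hd : HasDerivAt (fun t : ℝ => x + t • h) h t := by
    simpa using ((hasDerivAt_id t).smul_const h).const_add x
  have h2 := ((hv.differentiable one_ne_zero) (x + t • h)).hasFDerivAt.comp_hasDerivAt t hd
  rw [h2.deriv]
  rw [enorm_le_iff_norm_le, norm_mul, norm_norm, norm_norm]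
  exact ContinuousLinearMap.le_opNorm _ _

/-- The segment bound, Jensen on [0,1] and Tonelli reduce this to integrals of the translated
gradient, which do not depend on the translation. -/
theorem lintegral_enorm_translate_sub_rpow_le [FiniteDimensional ℝ E] [MeasurableSpace E]
    [BorelSpace E] (μ : Measure E) [SFinite μ] [μ.IsAddRightInvariant] {v : E → ℝ}
    (hv : ContDiff ℝ 1 v) {p : ℝ} (hp : 1 ≤ p) (h : E) :
    ∫⁻ x, ‖v (x + h) - v x‖ₑ ^ p ∂μ ≤ ‖h‖ₑ ^ p * ∫⁻ x, ‖fderiv ℝ v x‖ₑ ^ p ∂μ := by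
  have hp0 : 0 ≤ p := by linarith
  have hc : Continuous (fderiv ℝ v) := hv.continuous_fderiv one_ne_zero
  have : IsProbabilityMeasure (volume.restrict (Set.Icc (0 : ℝ) 1)) := ⟨by simp⟩
  calc ∫⁻ x, ‖v (x + h) - v x‖ₑ ^ p ∂μ
      ≤ ∫⁻ x, (∫⁻ t in Set.Icc (0 : ℝ) 1, ‖‖fderiv ℝ v (x + t • h)‖ * ‖h‖‖ₑ ^ p) ∂μ := by
        refine lintegral_mono fun x => ?_
        refine (ENNReal.rpow_le_rpow (enorm_translate_sub_le hv x h) hp0).trans ?_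
        exact lintegral_enorm_rpow_le_of_isProbabilityMeasure
          (Continuous.aestronglyMeasurable (by fun_prop)) hp
    _ = ∫⁻ t in Set.Icc (0 : ℝ) 1, ∫⁻ x, ‖‖fderiv ℝ v (x + t • h)‖ * ‖h‖‖ₑ ^ p ∂μ := by
        refine lintegral_lintegral_swap (Measurable.aemeasurable ?_)
        have : Continuous (fun z : E × ℝ => ‖fderiv ℝ v (z.1 + z.2 • h)‖ * ‖h‖) := by fun_prop
        exact this.measurable.enorm.pow_const p
    _ = ∫⁻ _ in Set.Icc (0 : ℝ) 1, ‖h‖ₑ ^ p * ∫⁻ x, ‖fderiv ℝ v x‖ₑ ^ p ∂μ := by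
        refine lintegral_congr fun t => ?_
        rw [lintegral_add_right_eq_self (fun x => ‖‖fderiv ℝ v x‖ * ‖h‖‖ₑ ^ p) (t • h),
          ← lintegral_const_mul _ (hc.measurable.enorm.pow_const p)]
        refine lintegral_congr fun x => ?_
        rw [enorm_mul, enorm_norm, enorm_norm, ENNReal.mul_rpow_of_nonneg _ _ hp0, mul_comm]
    _ = _ := by simp

end Translation

/-! ### The truncation profile -/

/-- A smooth even cutoff vanishing for `|s| ≤ 1` and equal to one for `|s|² ≥ 2`. -/
noncomputable def dyadicCutoff (s : ℝ) : ℝ := Real.smoothTransition (s ^ 2 - 1)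

theorem dyadicCutoff_contDiff : ContDiff ℝ 1 dyadicCutoff :=
  (Real.smoothTransition.contDiff (n := 1)).comp (by fun_prop)

theorem dyadicCutoff_eq_zero {s : ℝ} (hs : |s| ≤ 1) : dyadicCutoff s = 0 :=
  Real.smoothTransition.zero_of_nonpos (by
    have := (sq_le_one_iff_abs_le_one s).2 hs
    linarith)

theorem dyadicCutoff_eq_one {s : ℝ} (hs : 2 ≤ s ^ 2) : dyadicCutoff s = 1 :=
  Real.smoothTransition.one_of_one_le (by linarith)

theorem dyadicCutoff_nonneg (s : ℝ) : 0 ≤ dyadicCutoff s := Real.smoothTransition.nonneg _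

theorem dyadicCutoff_le_abs (s : ℝ) : dyadicCutoff s ≤ |s| := by
  rcases le_total |s| 1 with h | h
  · rw [dyadicCutoff_eq_zero h]; positivity
  · exact (Real.smoothTransition.le_one _).trans h

/-- The profile is already constant once s² ≥ 2, so the endpoint |s| = 2 can be excluded. The
half-open range is what makes the dyadic layers disjoint. -/
theorem deriv_dyadicCutoff_eq_zero {s : ℝ} (hs : |s| ∉ Set.Ico (1 : ℝ) 2) :
    deriv dyadicCutoff s = 0 := by
  rcases lt_or_ge |s| 1 with h | h
  · have : dyadicCutoff =ᶠ[𝓝 s] fun _ => 0 := by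
      filter_upwards [continuous_abs.continuousAt.eventually_lt continuousAt_const h] with t ht
      exact dyadicCutoff_eq_zero ht.le
    rw [this.deriv_eq, deriv_const]
  · have h2 : 2 ≤ |s| := by
      by_contra! h'
      exact hs ⟨h, h'⟩
    have h4 : 2 < s ^ 2 := by rw [← sq_abs]; nlinarith
    have : dyadicCutoff =ᶠ[𝓝 s] fun _ => 1 := by
      filter_upwards [continuousAt_const.eventually_lt (continuous_pow 2).continuousAt h4] with t ht
      exact dyadicCutoff_eq_one ht.le
    rw [this.deriv_eq, deriv_const]

theorem exists_deriv_dyadicCutoff_le : ∃ K : ℝ≥0, ∀ s, ‖deriv dyadicCutoff s‖ ≤ K := by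
  have hc : Continuous (deriv dyadicCutoff) := dyadicCutoff_contDiff.continuous_deriv le_rfl
  have hs : HasCompactSupport (deriv dyadicCutoff) := by
    refine HasCompactSupport.intro (isCompact_Icc (a := (-2 : ℝ)) (b := 2)) fun s hs => ?_
    refine deriv_dyadicCutoff_eq_zero fun h => hs ?_
    exact abs_le.1 h.2.le
  obtain ⟨K, hK⟩ := hs.exists_bound_of_continuous hc
  exact ⟨K.toNNReal, fun s => (hK s).trans (Real.le_coe_toNNReal K)⟩

/-! ### The truncated weak-type estimate -/

section Ball

open ProbabilityTheory

theorem lintegral_cond_ball_zero_add {E : Type*} [NormedAddCommGroup E] [MeasurableSpace E]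
    [BorelSpace E] (μ : Measure E) [μ.IsAddHaarMeasure] {R : ℝ} (f : E → ℝ≥0∞) (x : E) :
    ∫⁻ h, f (x + h) ∂cond μ (Metric.ball 0 R) = ∫⁻ y, f y ∂cond μ (Metric.ball x R) := by
  have hpre : (fun h => x + h) ⁻¹' Metric.ball x R = Metric.ball 0 R := by
    ext h; simp
  have h1 := (measurePreserving_add_left μ x).setLIntegral_comp_preimage_emb
    (MeasurableEquiv.addLeft x).measurableEmbedding f (Metric.ball x R)
  have h2 : μ (Metric.ball (0 : E) R) = μ (Metric.ball x R) := by
    exact (Measure.addHaar_ball_center μ x R).symm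
  rw [hpre] at h1
  simp only [ProbabilityTheory.cond, lintegral_smul_measure, h1, h2]

variable {E : Type*} [NormedAddCommGroup E] [NormedSpace ℝ E] [FiniteDimensional ℝ E]
  [MeasurableSpace E] [BorelSpace E] (μ : Measure E) [μ.IsAddHaarMeasure]

/-- A truncated weak-type estimate: if all averages of `|φ|` over balls of radius `R` are at most
half of the level `a`, then the superlevel set of height `2a` is controlled by the gradient of `φ`
on the layer where `|φ|` lies between `a` and `2a`. -/
theorem rpow_mul_measure_le_setLIntegral_fderiv {φ : E → ℝ} (hφ : ContDiff ℝ 1 φ) {p : ℝ}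
    (hp : 1 ≤ p) {K : ℝ≥0} (hK : ∀ s, ‖deriv dyadicCutoff s‖ ≤ K) {a R : ℝ} (ha : 0 < a)
    (hR : 0 < R)
    (havg : ∀ x, ∫⁻ y, ‖φ y‖ₑ ∂cond μ (Metric.ball x R) ≤ ENNReal.ofReal (a / 2)) :
    ENNReal.ofReal (a / 2) ^ p * μ {x | 2 * a ≤ |φ x|} ≤
      ENNReal.ofReal R ^ p * ((K : ℝ≥0∞) ^ p *
        ∫⁻ x in {x | |φ x| ∈ Set.Ico a (2 * a)}, ‖fderiv ℝ φ x‖ₑ ^ p ∂μ) := by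
  have hp0 : 0 ≤ p := by linarith
  set v : E → ℝ := fun x => a * dyadicCutoff (a⁻¹ * φ x) with hvdef
  have hv : ContDiff ℝ 1 v :=
    contDiff_const.mul (dyadicCutoff_contDiff.comp (contDiff_const.mul hφ))
  have hvc : Continuous v := hv.continuous
  set ν : Measure E := cond μ (Metric.ball 0 R) with hν
  have hνp : IsProbabilityMeasure ν := cond_isProbabilityMeasure_of_finite
    (Metric.measure_ball_pos μ 0 hR).ne' measure_ball_lt_top.ne
  have hφc : Continuous φ := hφ.continuous
  have habs (x : E) : |a⁻¹ * φ x| = a⁻¹ * |φ x| := by rw [abs_mul, abs_of_pos (inv_pos.2 ha)]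
  have hvle (x : E) : ‖v x‖ ≤ ‖φ x‖ := by
    rw [Real.norm_of_nonneg (mul_nonneg ha.le (dyadicCutoff_nonneg _)), Real.norm_eq_abs]
    calc a * dyadicCutoff (a⁻¹ * φ x) ≤ a * (a⁻¹ * |φ x|) := by
          rw [← habs]
          exact mul_le_mul_of_nonneg_left (dyadicCutoff_le_abs _) ha.le
      _ = _ := by field_simp
  have hveq {x : E} (hx : 2 * a ≤ |φ x|) : v x = a := by
    have h2 : 2 ≤ |a⁻¹ * φ x| := by
      rw [habs, inv_mul_eq_div, le_div_iff₀ ha]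
      exact hx
    have h4 : 2 ≤ (a⁻¹ * φ x) ^ 2 := by rw [← sq_abs]; nlinarith
    simp [hvdef, dyadicCutoff_eq_one h4]
  have hpoint {x : E} (hx : 2 * a ≤ |φ x|) :
      ENNReal.ofReal (a / 2) ^ p ≤ ∫⁻ h, ‖v (x + h) - v x‖ₑ ^ p ∂ν := by
    have hm : Measurable (fun h => ‖v (x + h) - v x‖ₑ) :=
      (Continuous.measurable (by fun_prop : Continuous fun h => v (x + h) - v x)).enorm
    -- Here v x = a, while the mean of |v| over the ball about x is at most that of |φ|, hence at
    -- most a/2.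
    have h1 : ENNReal.ofReal a ≤
        ∫⁻ h, ‖v (x + h) - v x‖ₑ ∂ν + ENNReal.ofReal (a / 2) := by
      calc ENNReal.ofReal a = ∫⁻ _, ENNReal.ofReal a ∂ν := by simp
        _ ≤ ∫⁻ h, (‖v (x + h) - v x‖ₑ + ‖φ (x + h)‖ₑ) ∂ν := by
            refine lintegral_mono fun h => ?_
            calc ENNReal.ofReal a = ‖v x‖ₑ := by
                  rw [hveq hx, Real.enorm_eq_ofReal ha.le]
              _ = ‖-(v (x + h) - v x) + v (x + h)‖ₑ := by congr 1; ring
              _ ≤ ‖-(v (x + h) - v x)‖ₑ + ‖v (x + h)‖ₑ := enorm_add_le _ _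
              _ ≤ _ := by
                  rw [enorm_neg]
                  gcongr
                  exact enorm_le_iff_norm_le.2 (hvle _)
        _ = ∫⁻ h, ‖v (x + h) - v x‖ₑ ∂ν + ∫⁻ y, ‖φ y‖ₑ ∂cond μ (Metric.ball x R) := by
            rw [lintegral_add_left hm, hν, lintegral_cond_ball_zero_add μ (fun y => ‖φ y‖ₑ) x]
        _ ≤ _ := by gcongr; exact havg x
    have h2 : ENNReal.ofReal (a / 2) ≤ ∫⁻ h, ‖v (x + h) - v x‖ₑ ∂ν := by
      have h3 : ENNReal.ofReal a = ENNReal.ofReal (a / 2) + ENNReal.ofReal (a / 2) := by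
        rw [← ENNReal.ofReal_add (by positivity) (by positivity), add_halves]
      rw [h3] at h1
      exact (ENNReal.add_le_add_iff_right ENNReal.ofReal_ne_top).1 h1
    exact (ENNReal.rpow_le_rpow h2 hp0).trans <|
      lintegral_enorm_rpow_le_of_isProbabilityMeasure
        (Continuous.aestronglyMeasurable (by fun_prop)) hp
  have hgrad : ∫⁻ x, ‖fderiv ℝ v x‖ₑ ^ p ∂μ ≤ (K : ℝ≥0∞) ^ p *
      ∫⁻ x in {x | |φ x| ∈ Set.Ico a (2 * a)}, ‖fderiv ℝ φ x‖ₑ ^ p ∂μ := by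
    have hms : MeasurableSet {x | |φ x| ∈ Set.Ico a (2 * a)} :=
      hφc.abs.measurable measurableSet_Ico
    have hm := ((hφ.continuous_fderiv one_ne_zero).measurable.enorm.pow_const p)
    rw [← lintegral_indicator hms, ← lintegral_const_mul _ (hm.indicator hms)]
    refine lintegral_mono fun x => ?_
    -- The outer factor a cancels the inner a⁻¹, so the gradient bound K does not depend on the
    -- level.
    have hfd : fderiv ℝ v x = deriv dyadicCutoff (a⁻¹ * φ x) • fderiv ℝ φ x := by
      have h1 : HasFDerivAt (fun x => a⁻¹ * φ x) (a⁻¹ • fderiv ℝ φ x) x :=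
        ((hφ.differentiable one_ne_zero) x).hasFDerivAt.const_mul a⁻¹
      have h2 := ((dyadicCutoff_contDiff.differentiable one_ne_zero)
        (a⁻¹ * φ x)).hasDerivAt.comp_hasFDerivAt x h1
      have h3 : HasFDerivAt v _ x := h2.const_mul a
      rw [h3.fderiv, smul_smul, smul_smul]
      congr 1
      field_simp
    by_cases hx : |φ x| ∈ Set.Ico a (2 * a)
    · rw [Set.indicator_of_mem (by exact hx), hfd, enorm_smul, ENNReal.mul_rpow_of_nonneg _ _ hp0]
      gcongr
      exact enorm_le_coe.2 (hK _)
    · have h0 : deriv dyadicCutoff (a⁻¹ * φ x) = 0 := by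
        refine deriv_dyadicCutoff_eq_zero fun h => hx ?_
        rw [habs, inv_mul_eq_div] at h
        exact ⟨(one_le_div ha).1 h.1, (div_lt_iff₀ ha).1 h.2⟩
      rw [hfd, h0, zero_smul, ← ofReal_norm, norm_zero, ENNReal.ofReal_zero,
        ENNReal.zero_rpow_of_pos (by linarith)]
      exact zero_le
  have hS : MeasurableSet {x | 2 * a ≤ |φ x|} := measurableSet_le measurable_const
    hφc.abs.measurable
  calc ENNReal.ofReal (a / 2) ^ p * μ {x | 2 * a ≤ |φ x|}
      = ∫⁻ _ in {x | 2 * a ≤ |φ x|}, ENNReal.ofReal (a / 2) ^ p ∂μ := by simp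
    _ ≤ ∫⁻ x in {x | 2 * a ≤ |φ x|}, (∫⁻ h, ‖v (x + h) - v x‖ₑ ^ p ∂ν) ∂μ :=
        setLIntegral_mono' hS fun x hx => hpoint hx
    _ ≤ ∫⁻ x, (∫⁻ h, ‖v (x + h) - v x‖ₑ ^ p ∂ν) ∂μ := setLIntegral_le_lintegral _ _
    _ = ∫⁻ h, (∫⁻ x, ‖v (x + h) - v x‖ₑ ^ p ∂μ) ∂ν := by
        refine lintegral_lintegral_swap (Measurable.aemeasurable ?_)
        have : Continuous (fun z : E × E => v (z.1 + z.2) - v z.1) := by fun_prop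
        exact this.measurable.enorm.pow_const p
    _ ≤ ∫⁻ _, ENNReal.ofReal R ^ p * ∫⁻ x, ‖fderiv ℝ v x‖ₑ ^ p ∂μ ∂ν := by
        refine lintegral_mono_ae ?_
        filter_upwards [ae_cond_mem (μ := μ) (measurableSet_ball (x := (0 : E)) (ε := R))] with h hh
        refine (lintegral_enorm_translate_sub_rpow_le μ hv hp h).trans ?_
        gcongr
        rw [← ofReal_norm]
        exact ENNReal.ofReal_le_ofReal (mem_ball_zero_iff.1 hh).le
    _ ≤ _ := by
        rw [lintegral_const, measure_univ, mul_one]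
        gcongr

end Ball

/-! ### Summation over dyadic levels -/

section DyadicSum

open ProbabilityTheory

variable {E : Type*} [NormedAddCommGroup E] [NormedSpace ℝ E] [FiniteDimensional ℝ E]
  [MeasurableSpace E] [BorelSpace E] (μ : Measure E) [μ.IsAddHaarMeasure]

/-- The weighted form of the truncated weak-type estimate under a Morrey bound. -/
theorem rpow_mul_measure_le_of_morrey_bound {φ : E → ℝ} (hφ : ContDiff ℝ 1 φ) {p α m : ℝ}
    (hp : 1 ≤ p) (hα : 0 < α) (hm : 0 < m) {K : ℝ≥0} (hK : ∀ s, ‖deriv dyadicCutoff s‖ ≤ K)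
    (hM : ∀ x R, 0 < R →
      ENNReal.ofReal (R ^ α) * ∫⁻ y, ‖φ y‖ₑ ∂cond μ (Metric.ball x R) ≤ ENNReal.ofReal m)
    {a : ℝ} (ha : 0 < a) :
    ENNReal.ofReal ((4 * a) ^ (p + p / α)) * μ {x | 2 * a ≤ |φ x|} ≤
      ENNReal.ofReal (4 ^ (p + p / α) * 2 ^ p * (2 * m) ^ (p / α)) * ((K : ℝ≥0∞) ^ p *
        ∫⁻ x in {x | |φ x| ∈ Set.Ico a (2 * a)}, ‖fderiv ℝ φ x‖ₑ ^ p ∂μ) := by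
  have hp0 : 0 ≤ p := by linarith
  have h2 : 0 < 2 * m / a := by positivity
  -- This radius turns the Morrey bound m into the mean bound m / R^α = a/2.
  set R : ℝ := (2 * m / a) ^ α⁻¹ with hRdef
  have hR : 0 < R := Real.rpow_pos_of_pos h2 _
  have hRα : R ^ α = 2 * m / a := Real.rpow_inv_rpow h2.le hα.ne'
  have havg (x : E) : ∫⁻ y, ‖φ y‖ₑ ∂cond μ (Metric.ball x R) ≤ ENNReal.ofReal (a / 2) := by
    have h := hM x R hR
    rw [hRα] at h
    have h0 : ENNReal.ofReal (2 * m / a) ≠ 0 := by simpa using h2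
    refine (ENNReal.mul_le_mul_iff_right h0 ENNReal.ofReal_ne_top).1 (h.trans_eq ?_)
    rw [← ENNReal.ofReal_mul h2.le]
    congr 1
    field_simp
  have hw := rpow_mul_measure_le_setLIntegral_fderiv μ hφ hp hK ha hR havg
  rw [ENNReal.ofReal_rpow_of_pos (by positivity), ENNReal.ofReal_rpow_of_pos hR] at hw
  have hRp : R ^ p = (2 * m) ^ (p / α) / a ^ (p / α) := by
    rw [hRdef, ← Real.rpow_mul h2.le, Real.div_rpow (by positivity) ha.le, inv_mul_eq_div]
  have hap : 0 < (a / 2) ^ p := by positivity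
  -- The weak-type estimate is multiplied by (4a)^q / (a/2)^p with q = p + p/α; against R^p all
  -- powers of a cancel.
  have hc : (4 * a) ^ (p + p / α) = (4 * a) ^ (p + p / α) / (a / 2) ^ p * (a / 2) ^ p := by
    field_simp
  have hc' : (4 * a) ^ (p + p / α) / (a / 2) ^ p * R ^ p =
      4 ^ (p + p / α) * 2 ^ p * (2 * m) ^ (p / α) := by
    rw [hRp, Real.mul_rpow (by norm_num) ha.le, Real.div_rpow ha.le (by norm_num),
      Real.rpow_add ha]
    field_simp
  rw [hc, ENNReal.ofReal_mul (by positivity), mul_assoc, ← hc', ENNReal.ofReal_mul (by positivity),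
    mul_assoc]
  gcongr

/-- The improved Sobolev inequality for smooth functions, with an explicit Morrey bound `m`. -/
theorem lintegral_rpow_le_of_morrey_bound {φ : E → ℝ} (hφ : ContDiff ℝ 1 φ) {p α m : ℝ}
    (hp : 1 ≤ p) (hα : 0 < α) (hm : 0 < m) {K : ℝ≥0} (hK : ∀ s, ‖deriv dyadicCutoff s‖ ≤ K)
    (hM : ∀ x R, 0 < R →
      ENNReal.ofReal (R ^ α) * ∫⁻ y, ‖φ y‖ₑ ∂cond μ (Metric.ball x R) ≤ ENNReal.ofReal m) :
    ∫⁻ x, ‖φ x‖ₑ ^ (p + p / α) ∂μ ≤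
      ENNReal.ofReal (4 ^ (p + p / α) * 2 ^ p * (2 * m) ^ (p / α)) *
        ((K : ℝ≥0∞) ^ p * ∫⁻ x, ‖fderiv ℝ φ x‖ₑ ^ p ∂μ) := by
  set q := p + p / α with hq
  have hq0 : 0 < q := by positivity
  have hφm : Measurable (fun x => |φ x|) := hφ.continuous.abs.measurable
  let S : ℤ → Set E := fun k => {x | 2 * (2 : ℝ) ^ k ≤ |φ x|}
  let L : ℤ → Set E := fun k => {x | |φ x| ∈ Set.Ico ((2 : ℝ) ^ k) (2 * 2 ^ k)}
  have hS (k : ℤ) : MeasurableSet (S k) := measurableSet_le measurable_const hφm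
  have hL (k : ℤ) : MeasurableSet (L k) := hφm measurableSet_Ico
  have hdisj : Pairwise (Function.onFun Disjoint L) := by
    intro j k hjk
    refine Set.disjoint_left.2 fun x (hj : |φ x| ∈ Set.Ico _ _) (hk : |φ x| ∈ Set.Ico _ _) => ?_
    simp only [← zpow_one_add₀ (two_ne_zero' ℝ), Set.mem_Ico] at hj hk
    have h1 := (zpow_lt_zpow_iff_right₀ one_lt_two).1 (hj.1.trans_lt hk.2)
    have h2 := (zpow_lt_zpow_iff_right₀ one_lt_two).1 (hk.1.trans_lt hj.2)
    omega
  have hpt (x : E) : ‖φ x‖ₑ ^ q ≤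
      ∑' k : ℤ, (S k).indicator (fun _ => ENNReal.ofReal ((4 * 2 ^ k) ^ q)) x := by
    rcases eq_or_ne (φ x) 0 with h0 | h0
    · simp [h0, hq0]
    · obtain ⟨n, hn⟩ := exists_mem_Ico_zpow (abs_pos.2 h0) (one_lt_two (α := ℝ))
      -- If 2^n ≤ |φ x| < 2^(n+1), the single level a = 2^(n-1) suffices, as then 2a = 2^n and 4a =
      -- 2^(n+1).
      refine le_trans ?_ (ENNReal.le_tsum (n - 1))
      have h2 : (2 : ℝ) * 2 ^ (n - 1) = 2 ^ n := by
        rw [← zpow_one_add₀ two_ne_zero]; congr 1; ring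
      have h4 : (4 : ℝ) * 2 ^ (n - 1) = 2 ^ (n + 1) := by
        rw [zpow_add_one₀ two_ne_zero, ← h2]; ring
      have hx : x ∈ S (n - 1) := h2.le.trans hn.1
      rw [Set.indicator_of_mem hx, h4, ← ENNReal.ofReal_rpow_of_pos (by positivity),
        Real.enorm_eq_ofReal_abs]
      gcongr
      exact hn.2.le
  calc ∫⁻ x, ‖φ x‖ₑ ^ q ∂μ
      ≤ ∫⁻ x, ∑' k : ℤ, (S k).indicator (fun _ => ENNReal.ofReal ((4 * 2 ^ k) ^ q)) x ∂μ :=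
        lintegral_mono hpt
    _ = ∑' k : ℤ, ENNReal.ofReal ((4 * 2 ^ k) ^ q) * μ (S k) := by
        rw [lintegral_tsum fun k => (measurable_const.indicator (hS k)).aemeasurable]
        exact tsum_congr fun k => lintegral_indicator_const (hS k) _
    _ ≤ ∑' k : ℤ, ENNReal.ofReal (4 ^ q * 2 ^ p * (2 * m) ^ (p / α)) *
          ((K : ℝ≥0∞) ^ p * ∫⁻ x in L k, ‖fderiv ℝ φ x‖ₑ ^ p ∂μ) :=
        ENNReal.tsum_le_tsum fun k =>
          rpow_mul_measure_le_of_morrey_bound μ hφ hp hα hm hK hM (by positivity)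
    _ = ENNReal.ofReal (4 ^ q * 2 ^ p * (2 * m) ^ (p / α)) *
          ((K : ℝ≥0∞) ^ p * ∫⁻ x in ⋃ k, L k, ‖fderiv ℝ φ x‖ₑ ^ p ∂μ) := by
        rw [ENNReal.tsum_mul_left, ENNReal.tsum_mul_left, lintegral_iUnion hL hdisj]
    _ ≤ _ := by
        gcongr
        exact Measure.restrict_le_self

end DyadicSum

/-! ### Morrey norms -/

section Morrey

open ProbabilityTheory

variable {N : ℕ}

/-- With γ = rα the weight outside the r-th root is R^α for every r, so Morrey estimates reduce to
L^r estimates on balls with normalized measure. -/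
theorem morreyNorm_le_iff {r α : ℝ} (hr : 0 < r) {u : EuclideanSpace ℝ (Fin N) → ℝ} {b : ℝ≥0∞} :
    morreyNorm r (r * α) u ≤ b ↔ ∀ x R, 0 < R →
      ENNReal.ofReal (R ^ α) * eLpNorm' u r (cond volume (Metric.ball x R)) ≤ b := by
  rw [morreyNorm, one_div, ENNReal.rpow_inv_le_iff hr]
  simp only [iSup_le_iff]
  refine forall₃_congr fun x R hR => ?_
  rw [← ENNReal.rpow_inv_le_iff hr, ENNReal.mul_rpow_of_nonneg _ _ (inv_nonneg.2 hr.le),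
    ENNReal.ofReal_rpow_of_pos (Real.rpow_pos_of_pos hR _), ← Real.rpow_mul hR.le, eLpNorm',
    one_div, mul_assoc, mul_comm α, mul_inv_cancel_left₀ hr.ne', setLAverage_eq']
  rfl

theorem mul_eLpNorm'_le_morreyNorm {r α : ℝ} (hr : 0 < r) (u : EuclideanSpace ℝ (Fin N) → ℝ)
    (x : EuclideanSpace ℝ (Fin N)) {R : ℝ} (hR : 0 < R) :
    ENNReal.ofReal (R ^ α) * eLpNorm' u r (cond volume (Metric.ball x R)) ≤
      morreyNorm r (r * α) u :=
  (morreyNorm_le_iff hr).1 le_rfl x R hR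

theorem isProbabilityMeasure_cond_ball (x : EuclideanSpace ℝ (Fin N)) {R : ℝ} (hR : 0 < R) :
    IsProbabilityMeasure (cond volume (Metric.ball x R)) :=
  cond_isProbabilityMeasure_of_finite (Metric.measure_ball_pos _ x hR).ne' measure_ball_lt_top.ne

theorem morreyNorm_mono_exponent {r s α : ℝ} (hr : 0 < r) (hrs : r ≤ s)
    {u : EuclideanSpace ℝ (Fin N) → ℝ} (hu : AEStronglyMeasurable u volume) :
    morreyNorm r (r * α) u ≤ morreyNorm s (s * α) u := by
  refine (morreyNorm_le_iff hr).2 fun x R hR => ?_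
  have := isProbabilityMeasure_cond_ball x hR
  refine le_trans ?_ (mul_eLpNorm'_le_morreyNorm (hr.trans_le hrs) u x hR)
  gcongr
  exact eLpNorm'_le_eLpNorm'_of_exponent_le hr hrs _ (hu.mono_ac cond_absolutelyContinuous)

theorem morreyNorm_add_le {r α : ℝ} (hr : 1 ≤ r) {u v : EuclideanSpace ℝ (Fin N) → ℝ}
    (hu : AEStronglyMeasurable u volume) (hv : AEStronglyMeasurable v volume) :
    morreyNorm r (r * α) (u + v) ≤ morreyNorm r (r * α) u + morreyNorm r (r * α) v := by
  have hr0 : 0 < r := by linarith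
  refine (morreyNorm_le_iff hr0).2 fun x R hR => ?_
  calc _ ≤ ENNReal.ofReal (R ^ α) * (eLpNorm' u r (cond volume (Metric.ball x R)) +
        eLpNorm' v r (cond volume (Metric.ball x R))) := by
        gcongr
        exact eLpNorm'_add_le (hu.mono_ac cond_absolutelyContinuous)
          (hv.mono_ac cond_absolutelyContinuous) hr
    _ ≤ _ := by
        rw [mul_add]
        exact add_le_add (mul_eLpNorm'_le_morreyNorm hr0 u x hR)
          (mul_eLpNorm'_le_morreyNorm hr0 v x hR)

/-- The embedding of `L^q` into the scale-invariant Morrey spaces. -/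
theorem morreyNorm_le_eLpNorm {r q α : ℝ} (hr : 0 < r) (hrq : r ≤ q) (hα : α * q = N)
    {u : EuclideanSpace ℝ (Fin N) → ℝ} (hu : AEStronglyMeasurable u volume) :
    morreyNorm r (r * α) u ≤
      (volume (Metric.ball (0 : EuclideanSpace ℝ (Fin N)) 1))⁻¹ ^ (1 / q) *
        eLpNorm u (ENNReal.ofReal q) volume := by
  have hq : 0 < q := hr.trans_le hrq
  -- Raising the exponent to q first keeps the constant independent of r.
  refine (morreyNorm_mono_exponent hr hrq hu).trans ((morreyNorm_le_iff hq).2 fun x R hR => ?_)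
  have hB : volume (Metric.ball (0 : EuclideanSpace ℝ (Fin N)) 1) ≠ 0 :=
    (Metric.measure_ball_pos _ _ one_pos).ne'
  have hRN : ENNReal.ofReal (R ^ N) ≠ 0 := by simpa using pow_pos hR N
  have h1 : ENNReal.ofReal (R ^ α) * (volume (Metric.ball x R))⁻¹ ^ (1 / q) =
      (volume (Metric.ball (0 : EuclideanSpace ℝ (Fin N)) 1))⁻¹ ^ (1 / q) := by
    have h2 : ENNReal.ofReal (R ^ α) = ENNReal.ofReal (R ^ N) ^ (1 / q) := by
      rw [ENNReal.ofReal_rpow_of_pos (pow_pos hR N), ← Real.rpow_natCast, ← hα,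
        ← Real.rpow_mul hR.le, mul_assoc, mul_one_div_cancel hq.ne', mul_one]
    rw [h2, ← ENNReal.mul_rpow_of_nonneg _ _ (by positivity), Measure.addHaar_ball_of_pos _ _ hR,
      finrank_euclideanSpace_fin, ENNReal.mul_inv (Or.inl hRN) (Or.inl ENNReal.ofReal_ne_top),
      ← mul_assoc, ENNReal.mul_inv_cancel hRN ENNReal.ofReal_ne_top, one_mul]
  rw [ProbabilityTheory.cond, eLpNorm'_smul_measure hq.le, ← mul_assoc, h1,
    eLpNorm_eq_eLpNorm' (by simpa using hq) ENNReal.ofReal_ne_top, ENNReal.toReal_ofReal hq.le]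
  gcongr
  exact Measure.restrict_le_self

end Morrey

/-! ### Sobolev inequalities for test functions -/

section Sobolev

variable {N : ℕ}

theorem norm_gradient_eq_norm_fderiv (φ : EuclideanSpace ℝ (Fin N) → ℝ)
    (x : EuclideanSpace ℝ (Fin N)) : ‖gradient φ x‖ = ‖fderiv ℝ φ x‖ := by
  rw [← toDual_gradient, LinearIsometryEquiv.norm_map]

theorem IsTestFunction.sub {φ ψ : EuclideanSpace ℝ (Fin N) → ℝ} (hφ : IsTestFunction φ)
    (hψ : IsTestFunction ψ) : IsTestFunction (φ - ψ) :=
  ⟨hφ.1.sub hψ.1, hφ.2.sub hψ.2⟩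

theorem IsTestFunction.contDiff_one {φ : EuclideanSpace ℝ (Fin N) → ℝ} (hφ : IsTestFunction φ) :
    ContDiff ℝ 1 φ :=
  hφ.1.of_le (by exact_mod_cast le_top)

theorem IsTestFunction.differentiable {φ : EuclideanSpace ℝ (Fin N) → ℝ} (hφ : IsTestFunction φ) :
    Differentiable ℝ φ :=
  hφ.contDiff_one.differentiable one_ne_zero

theorem IsTestFunction.continuous_gradient {φ : EuclideanSpace ℝ (Fin N) → ℝ}
    (hφ : IsTestFunction φ) : Continuous (gradient φ) :=
  (InnerProductSpace.toDual ℝ _).symm.continuous.comp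
    (hφ.contDiff_one.continuous_fderiv one_ne_zero)

theorem IsTestFunction.gradient_sub {φ ψ : EuclideanSpace ℝ (Fin N) → ℝ} (hφ : IsTestFunction φ)
    (hψ : IsTestFunction ψ) : gradient (φ - ψ) = gradient φ - gradient ψ := by
  ext1 x
  rw [Pi.sub_apply, gradient, gradient, gradient, fderiv_sub (hφ.differentiable x)
    (hψ.differentiable x), map_sub]

theorem sobolevExponent_relations {p : ℝ} (hp : 1 ≤ p) (hpN : p < N) :
    p < sobolevExponent N p ∧ (N - p) / p * sobolevExponent N p = N ∧
      sobolevExponent N p = p + p / ((N - p) / p) ∧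
      (sobolevExponent N p)⁻¹ = p⁻¹ - (N : ℝ)⁻¹ := by
  have h1 : (0 : ℝ) < N - p := by linarith
  have h2 : (0 : ℝ) < p := by linarith
  have h3 : (0 : ℝ) < N := by linarith
  unfold sobolevExponent
  refine ⟨?_, ?_, ?_, ?_⟩
  · rw [lt_div_iff₀ h1]
    nlinarith
  · field_simp
  · field_simp
    ring
  · field_simp

/-- The Gagliardo–Nirenberg–Sobolev inequality. It supplies finiteness of the L^q norm, L^q
convergence of approximants, and control of the Morrey norm by the gradient. -/
theorem exists_sobolev_const {p : ℝ} (hp : 1 ≤ p) (hpN : p < N) :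
    ∃ C : ℝ≥0, ∀ φ : EuclideanSpace ℝ (Fin N) → ℝ, IsTestFunction φ →
      eLpNorm φ (ENNReal.ofReal (sobolevExponent N p)) volume ≤
        C * eLpNorm (gradient φ) (ENNReal.ofReal p) volume := by
  obtain ⟨hpq, -, -, hq⟩ := sobolevExponent_relations hp hpN
  refine ⟨SNormLESNormFDerivOfEqConst ℝ
    (volume : Measure (EuclideanSpace ℝ (Fin N))) p.toNNReal, fun φ hφ => ?_⟩
  have hp' : ((p.toNNReal : ℝ≥0) : ℝ) = p := Real.coe_toNNReal _ (by linarith)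
  have h := eLpNorm_le_eLpNorm_fderiv_of_eq volume hφ.contDiff_one hφ.2
    (p := p.toNNReal) (p' := (sobolevExponent N p).toNNReal) (by simpa using hp)
    (by
      rw [finrank_euclideanSpace_fin]
      exact_mod_cast (by linarith : (0 : ℝ) < N))
    (by
      rw [finrank_euclideanSpace_fin, NNReal.coe_inv, hp', Real.coe_toNNReal _ (by linarith), hq])
  refine h.trans_eq ?_
  rw [hp']
  congr 1
  exact eLpNorm_congr_norm_ae (ae_of_all _ fun x => (norm_gradient_eq_norm_fderiv φ x).symm)

/-- The improved Sobolev inequality for test functions. -/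
theorem exists_improved_sobolev_const_of_isTestFunction {p : ℝ} (hp : 1 ≤ p) (hpN : p < N) :
    ∃ C : ℝ≥0, ∀ φ : EuclideanSpace ℝ (Fin N) → ℝ, IsTestFunction φ → ∀ m : ℝ, 0 < m →
      morreyNorm 1 (1 * ((N - p) / p)) φ ≤ ENNReal.ofReal m →
      eLpNorm φ (ENNReal.ofReal (sobolevExponent N p)) volume ≤
        C * ENNReal.ofReal m ^ (1 - p / sobolevExponent N p) *
          eLpNorm (gradient φ) (ENNReal.ofReal p) volume ^ (p / sobolevExponent N p) := by
  obtain ⟨hpq, hαq, hq, -⟩ := sobolevExponent_relations hp hpN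
  obtain ⟨K, hK⟩ := exists_deriv_dyadicCutoff_le
  have hp0 : 0 < p := by linarith
  set q := sobolevExponent N p
  set α : ℝ := (N - p) / p
  have hα : 0 < α := div_pos (by linarith) hp0
  have hq0 : 0 < q := by linarith
  set D : ℝ := 4 ^ q * 2 ^ p * 2 ^ (p / α) with hD
  have hD0 : 0 ≤ D := by positivity
  refine ⟨(D.toNNReal * K ^ p) ^ (1 / q), fun φ hφ m hm hM => ?_⟩
  have h := lintegral_rpow_le_of_morrey_bound volume hφ.contDiff_one hp hα hm hK fun x R hR => by
    simpa [eLpNorm'] using (morreyNorm_le_iff one_pos).1 hM x R hR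
  rw [← hq, Real.mul_rpow zero_le_two hm.le, ← mul_assoc, ← mul_assoc (4 ^ q * 2 ^ p), ← hD,
    ENNReal.ofReal_mul hD0] at h
  -- This is where q = p + p/α produces the interpolation exponent.
  have hexp : p / α * (1 / q) = 1 - p / q := by
    rw [hq]; field_simp; ring
  have hG : eLpNorm (gradient φ) (ENNReal.ofReal p) volume ^ (p / q) =
      (∫⁻ x, ‖fderiv ℝ φ x‖ₑ ^ p) ^ (1 / q) := by
    rw [eLpNorm_congr_norm_ae (g := fderiv ℝ φ)
      (ae_of_all _ fun x => norm_gradient_eq_norm_fderiv φ x),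
      eLpNorm_eq_eLpNorm' (by simpa using hp0) ENNReal.ofReal_ne_top, ENNReal.toReal_ofReal hp0.le,
      eLpNorm', ← ENNReal.rpow_mul]
    congr 1
    field_simp
  rw [hG, eLpNorm_eq_eLpNorm' (by simpa using hq0) ENNReal.ofReal_ne_top,
    ENNReal.toReal_ofReal hq0.le, eLpNorm']
  calc _ ≤ _ := ENNReal.rpow_le_rpow h (by positivity)
    _ = (ENNReal.ofReal D * (K : ℝ≥0∞) ^ p * ENNReal.ofReal (m ^ (p / α)) *
          ∫⁻ x, ‖fderiv ℝ φ x‖ₑ ^ p) ^ (1 / q) := by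
        congr 1; ring
    _ = _ := by
        rw [ENNReal.mul_rpow_of_nonneg _ _ (by positivity),
          ENNReal.mul_rpow_of_nonneg _ _ (by positivity), ← ENNReal.ofReal_rpow_of_pos hm,
          ← ENNReal.rpow_mul, hexp, ENNReal.coe_rpow_of_nonneg _ (by positivity), ENNReal.coe_mul,
          ENNReal.coe_rpow_of_nonneg _ hp0.le]
        rfl

end Sobolev

/-! ### Lower semicontinuity -/

section Limit

variable {N : ℕ}

/-- Lower semicontinuity of the `L^q` norm under convergence in `L¹` on compact sets. -/
theorem eLpNorm_le_of_tendsto_on_compacts {q : ℝ} (hq : 0 < q) {C : ℝ≥0∞}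
    {f : ℕ → EuclideanSpace ℝ (Fin N) → ℝ} {u : EuclideanSpace ℝ (Fin N) → ℝ}
    (hf : ∀ n, AEStronglyMeasurable (f n) volume) (hu : AEStronglyMeasurable u volume)
    (hlim : ∀ K : Set (EuclideanSpace ℝ (Fin N)), IsCompact K →
      Tendsto (fun n => eLpNorm (f n - u) 1 (volume.restrict K)) atTop (𝓝 0))
    (hC : ∀ᶠ n in atTop, eLpNorm (f n) (ENNReal.ofReal q) volume ≤ C) :
    eLpNorm u (ENNReal.ofReal q) volume ≤ C := by
  have hq0 : ENNReal.ofReal q ≠ 0 := by simpa using hq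
  -- Convergence in L¹ on a ball gives convergence in measure, under which the L^q norm is lower
  -- semicontinuous; the balls then exhaust the space.
  have hball (j : ℕ) : ∫⁻ x in Metric.closedBall 0 (j : ℝ), ‖u x‖ₑ ^ q ≤ C ^ q := by
    have h := eLpNorm_le_of_tendstoInMeasure (p := ENNReal.ofReal q)
      (hC.mono fun n hn => (eLpNorm_restrict_le (f n) _ _ _).trans hn)
      (tendstoInMeasure_of_tendsto_eLpNorm one_ne_zero (fun n => (hf n).restrict) hu.restrict
        (hlim (Metric.closedBall 0 j) (isCompact_closedBall _ _))) fun n => (hf n).restrict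
    rw [eLpNorm_eq_eLpNorm' hq0 ENNReal.ofReal_ne_top, ENNReal.toReal_ofReal hq.le, eLpNorm',
      one_div, ENNReal.rpow_inv_le_iff hq] at h
    exact h
  have hmono : Monotone fun j : ℕ => Metric.closedBall (0 : EuclideanSpace ℝ (Fin N)) (j : ℝ) :=
    fun i j hij => Metric.closedBall_subset_closedBall (by exact_mod_cast hij)
  rw [eLpNorm_eq_eLpNorm' hq0 ENNReal.ofReal_ne_top, ENNReal.toReal_ofReal hq.le, eLpNorm',
    one_div, ENNReal.rpow_inv_le_iff hq, ← setLIntegral_univ, ← Metric.iUnion_closedBall_nat 0,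
    setLIntegral_iUnion_of_directed _ hmono.directed_le]
  exact iSup_le hball

end Limit

/-! ### Passage to the homogeneous Sobolev space -/

section Closure

variable {N : ℕ}

/-- The approximating test functions converge in `L^{p*}`. -/
theorem tendsto_eLpNorm_sub_of_tendsto_gradient {p q : ℝ} (hp : 1 ≤ p) (hq : 1 ≤ q) {C : ℝ≥0}
    (hC : ∀ φ : EuclideanSpace ℝ (Fin N) → ℝ, IsTestFunction φ →
      eLpNorm φ (ENNReal.ofReal q) volume ≤ C * eLpNorm (gradient φ) (ENNReal.ofReal p) volume)
    {φ : ℕ → EuclideanSpace ℝ (Fin N) → ℝ} (hφ : ∀ n, IsTestFunction (φ n))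
    {u : EuclideanSpace ℝ (Fin N) → ℝ} (hu : AEStronglyMeasurable u volume)
    {g : EuclideanSpace ℝ (Fin N) → EuclideanSpace ℝ (Fin N)} (hg : AEStronglyMeasurable g volume)
    (hφg : Tendsto (fun n => eLpNorm (gradient (φ n) - g) (ENNReal.ofReal p) volume) atTop (𝓝 0))
    (hφu : ∀ K : Set (EuclideanSpace ℝ (Fin N)), IsCompact K →
      Tendsto (fun n => eLpNorm (φ n - u) 1 (volume.restrict K)) atTop (𝓝 0)) :
    Tendsto (fun n => eLpNorm (φ n - u) (ENNReal.ofReal q) volume) atTop (𝓝 0) := by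
  have hp1 : 1 ≤ ENNReal.ofReal p := by simpa using hp
  have hφm (n : ℕ) : AEStronglyMeasurable (φ n) volume :=
    (hφ n).contDiff_one.continuous.aestronglyMeasurable
  have hgm (n : ℕ) : AEStronglyMeasurable (gradient (φ n) - g) volume :=
    (hφ n).continuous_gradient.aestronglyMeasurable.sub hg
  set δ : ℕ → ℝ≥0∞ := fun n => eLpNorm (gradient (φ n) - g) (ENNReal.ofReal p) volume with hδ
  have hdiff (n m : ℕ) : eLpNorm (φ n - φ m) (ENNReal.ofReal q) volume ≤ C * (δ n + δ m) := by
    refine (hC _ ((hφ n).sub (hφ m))).trans ?_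
    gcongr
    rw [(hφ n).gradient_sub (hφ m), ← sub_sub_sub_cancel_right _ _ g]
    exact eLpNorm_sub_le (hgm n) (hgm m) hp1
  -- For fixed n, let m → ∞ in the Sobolev bound for φ n - φ m, with δ m < ε eventually; afterwards
  -- ε → 0.
  have hbound {ε : ℝ≥0∞} (hε : 0 < ε) (n : ℕ) :
      eLpNorm (φ n - u) (ENNReal.ofReal q) volume ≤ C * (δ n + ε) := by
    refine eLpNorm_le_of_tendsto_on_compacts (by linarith) (f := fun m => φ n - φ m)
      (fun m => (hφm n).sub (hφm m)) ((hφm n).sub hu) (fun K hK => ?_) ?_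
    · refine (hφu K hK).congr fun m => ?_
      rw [sub_sub_sub_cancel_left, eLpNorm_sub_comm]
    · filter_upwards [hφg.eventually (gt_mem_nhds hε)] with m hm
      refine (hdiff n m).trans ?_
      gcongr
  have hle (n : ℕ) : eLpNorm (φ n - u) (ENNReal.ofReal q) volume ≤ C * δ n := by
    have ht : Tendsto (fun ε : ℝ≥0∞ => C * (δ n + ε)) (𝓝[>] 0) (𝓝 (C * (δ n + 0))) :=
      (ENNReal.Tendsto.const_mul (tendsto_const_nhds.add tendsto_id)
        (Or.inr ENNReal.coe_ne_top)).mono_left nhdsWithin_le_nhds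
    rw [add_zero] at ht
    exact ge_of_tendsto ht (eventually_mem_nhdsWithin.mono fun ε hε => hbound hε n)
  refine tendsto_of_tendsto_of_tendsto_of_le_of_le tendsto_const_nhds ?_ (fun _ => zero_le) hle
  simpa using ENNReal.Tendsto.const_mul hφg (Or.inr (ENNReal.coe_ne_top (r := C)))

/-- The Sobolev inequality in the homogeneous Sobolev space, together with the improved inequality
at the endpoint `θ = p / p*`, `r = 1`. -/
theorem exists_improved_sobolev_const {p : ℝ} (hp : 1 ≤ p) (hpN : p < N) :
    ∃ C : ℝ≥0, ∀ (u : EuclideanSpace ℝ (Fin N) → ℝ)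
      (g : EuclideanSpace ℝ (Fin N) → EuclideanSpace ℝ (Fin N)), MemHomogeneousSobolev p u g →
      eLpNorm u (ENNReal.ofReal (sobolevExponent N p)) volume ≤
        C * eLpNorm g (ENNReal.ofReal p) volume ∧
      eLpNorm u (ENNReal.ofReal (sobolevExponent N p)) volume ≤
        C * morreyNorm 1 (1 * ((N - p) / p)) u ^ (1 - p / sobolevExponent N p) *
          eLpNorm g (ENNReal.ofReal p) volume ^ (p / sobolevExponent N p) := by
  obtain ⟨C₁, hC₁⟩ := exists_sobolev_const hp hpN
  obtain ⟨C₂, hC₂⟩ := exists_improved_sobolev_const_of_isTestFunction hp hpN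
  obtain ⟨hpq, hαq, -, -⟩ := sobolevExponent_relations hp hpN
  refine ⟨max C₁ C₂, fun u g hug => ?_⟩
  obtain ⟨φ, hφ, hφg, hφu⟩ := hug.exists_approx
  set q := sobolevExponent N p
  set α : ℝ := (N - p) / p
  have hp1 : 1 ≤ ENNReal.ofReal p := by simpa using hp
  have hq1 : 1 ≤ ENNReal.ofReal q := by simpa using hp.trans hpq.le
  have hq0 : 0 < q := by linarith
  have hu : AEStronglyMeasurable u volume := hug.hasWeakGradient.1.aestronglyMeasurable
  have hg : AEStronglyMeasurable g volume := hug.memLp.1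
  have hφm (n : ℕ) : AEStronglyMeasurable (φ n) volume :=
    (hφ n).contDiff_one.continuous.aestronglyMeasurable
  set G := eLpNorm g (ENNReal.ofReal p) volume with hG
  have hGtop : G ≠ ⊤ := hug.memLp.2.ne
  set δ : ℕ → ℝ≥0∞ := fun n => eLpNorm (gradient (φ n) - g) (ENNReal.ofReal p) volume with hδ
  set η : ℕ → ℝ≥0∞ := fun n => eLpNorm (φ n - u) (ENNReal.ofReal q) volume with hη
  have hδ0 : Tendsto δ atTop (𝓝 0) := hφg
  have hη0 : Tendsto η atTop (𝓝 0) :=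
    tendsto_eLpNorm_sub_of_tendsto_gradient hp (by linarith) hC₁ hφ hu hg hφg hφu
  have hgrad (n : ℕ) : eLpNorm (gradient (φ n)) (ENNReal.ofReal p) volume ≤ δ n + G := by
    have h := eLpNorm_add_le ((hφ n).continuous_gradient.aestronglyMeasurable.sub hg) hg hp1
    rwa [sub_add_cancel] at h
  have hun (n : ℕ) : eLpNorm u (ENNReal.ofReal q) volume ≤
      η n + eLpNorm (φ n) (ENNReal.ofReal q) volume := by
    have h := eLpNorm_sub_le (hφm n) ((hφm n).sub hu) hq1
    rw [sub_sub_cancel] at h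
    rwa [add_comm]
  have hδG : Tendsto (fun n => δ n + G) atTop (𝓝 G) := by
    simpa using hδ0.add (tendsto_const_nhds (x := G))
  have hsob : eLpNorm u (ENNReal.ofReal q) volume ≤ C₁ * G := by
    have ht : Tendsto (fun n => η n + C₁ * (δ n + G)) atTop (𝓝 (0 + C₁ * G)) :=
      hη0.add (ENNReal.Tendsto.const_mul hδG (Or.inr ENNReal.coe_ne_top))
    rw [zero_add] at ht
    refine ge_of_tendsto' ht fun n => (hun n).trans ?_
    gcongr
    exact (hC₁ _ (hφ n)).trans (by gcongr; exact hgrad n)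
  refine ⟨hsob.trans (by gcongr; exact le_max_left _ _), ?_⟩
  set B : ℝ≥0∞ := (volume (Metric.ball (0 : EuclideanSpace ℝ (Fin N)) 1))⁻¹ ^ (1 / q) with hBdef
  have hB : B ≠ ⊤ := ENNReal.rpow_ne_top_of_nonneg (by positivity)
    (ENNReal.inv_ne_top.2 (Metric.measure_ball_pos _ _ one_pos).ne')
  set M := morreyNorm 1 (1 * α) u with hM
  have hMtop : M ≠ ⊤ := by
    refine ne_top_of_le_ne_top ?_ (morreyNorm_le_eLpNorm one_pos (by linarith) hαq hu)
    exact ENNReal.mul_ne_top hB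
      (ne_top_of_le_ne_top (ENNReal.mul_ne_top ENNReal.coe_ne_top hGtop) hsob)
  have hMn (n : ℕ) : morreyNorm 1 (1 * α) (φ n) ≤ B * η n + M := by
    have h := morreyNorm_add_le (α := α) le_rfl ((hφm n).sub hu) hu
    rw [sub_add_cancel] at h
    exact h.trans
      (by gcongr; exact morreyNorm_le_eLpNorm one_pos (by linarith) hαq ((hφm n).sub hu))
  have hθ0 : 0 ≤ p / q := by positivity
  have hθ1 : 0 ≤ 1 - p / q := sub_nonneg.2 ((div_le_one hq0).2 hpq.le)
  have hGθ : G ^ (p / q) ≠ ⊤ := ENNReal.rpow_ne_top_of_nonneg hθ0 hGtop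
  -- A strict majorant m is positive and eventually dominates the Morrey norms of the φ n; letting m
  -- decrease to M also covers M = 0.
  have hbound {m : ℝ} (hm : M.toReal < m) : eLpNorm u (ENNReal.ofReal q) volume ≤
      C₂ * ENNReal.ofReal m ^ (1 - p / q) * G ^ (p / q) := by
    have hMm : M < ENNReal.ofReal m := (ENNReal.lt_ofReal_iff_toReal_lt hMtop).2 hm
    have hlim : Tendsto (fun n => B * η n + M) atTop (𝓝 M) := by
      simpa using (ENNReal.Tendsto.const_mul hη0 (Or.inr hB)).add (tendsto_const_nhds (x := M))
    have hcoef : C₂ * ENNReal.ofReal m ^ (1 - p / q) ≠ ⊤ :=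
      ENNReal.mul_ne_top ENNReal.coe_ne_top
        (ENNReal.rpow_ne_top_of_nonneg hθ1 ENNReal.ofReal_ne_top)
    have ht : Tendsto (fun n => η n + C₂ * ENNReal.ofReal m ^ (1 - p / q) * (δ n + G) ^ (p / q))
        atTop (𝓝 (0 + C₂ * ENNReal.ofReal m ^ (1 - p / q) * G ^ (p / q))) :=
      hη0.add (ENNReal.Tendsto.const_mul
        ((ENNReal.continuous_rpow_const.tendsto G).comp hδG) (Or.inr hcoef))
    rw [zero_add] at ht
    refine ge_of_tendsto ht ?_
    filter_upwards [hlim.eventually (gt_mem_nhds hMm)] with n hn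
    refine (hun n).trans ?_
    gcongr
    refine (hC₂ _ (hφ n) m (ENNReal.toReal_nonneg.trans_lt hm) ((hMn n).trans hn.le)).trans ?_
    gcongr
    exact hgrad n
  have hfinal : eLpNorm u (ENNReal.ofReal q) volume ≤ C₂ * M ^ (1 - p / q) * G ^ (p / q) := by
    have ht : Tendsto (fun m : ℝ => C₂ * ENNReal.ofReal m ^ (1 - p / q) * G ^ (p / q))
        (𝓝[>] M.toReal)
        (𝓝 (C₂ * ENNReal.ofReal M.toReal ^ (1 - p / q) * G ^ (p / q))) := by
      refine Tendsto.mono_left ?_ nhdsWithin_le_nhds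
      refine ENNReal.Tendsto.mul_const ?_ (Or.inr hGθ)
      refine ENNReal.Tendsto.const_mul ?_ (Or.inr ENNReal.coe_ne_top)
      exact (ENNReal.continuous_rpow_const.tendsto _).comp (ENNReal.continuous_ofReal.tendsto _)
    rw [ENNReal.ofReal_toReal hMtop] at ht
    exact ge_of_tendsto ht (eventually_mem_nhdsWithin.mono fun m hm => hbound hm)
  exact hfinal.trans (by gcongr; exact le_max_right _ _)

end Closure

/-! ### The full range of θ and r -/

theorem theorem1p2 (N : ℕ) (p : ℝ) (hp : 1 ≤ p) (hpN : p < N) :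
    ∃ C : ℝ≥0, ∀ θ r : ℝ, p / sobolevExponent N p ≤ θ → θ < 1 →
      1 ≤ r → r < sobolevExponent N p →
      ∀ (u : EuclideanSpace ℝ (Fin N) → ℝ)
        (g : EuclideanSpace ℝ (Fin N) → EuclideanSpace ℝ (Fin N)),
        MemHomogeneousSobolev p u g →
        MemLp u (ENNReal.ofReal (sobolevExponent N p)) volume ∧
        MemMorrey r (r * (N - p) / p) u ∧
        eLpNorm u (ENNReal.ofReal (sobolevExponent N p)) volume ≤
          C * eLpNorm g (ENNReal.ofReal p) volume ^ θ *
            morreyNorm r (r * (N - p) / p) u ^ (1 - θ) := by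
  obtain ⟨C, hC⟩ := exists_improved_sobolev_const hp hpN
  obtain ⟨hpq, hαq, -, -⟩ := sobolevExponent_relations hp hpN
  set q := sobolevExponent N p
  set B : ℝ≥0∞ := (volume (Metric.ball (0 : EuclideanSpace ℝ (Fin N)) 1))⁻¹ ^ (1 / q) with hBdef
  have hq0 : 0 < q := by linarith
  have hB : B ≠ ⊤ := ENNReal.rpow_ne_top_of_nonneg (by positivity)
    (ENNReal.inv_ne_top.2 (Metric.measure_ball_pos _ _ one_pos).ne')
  lift B to ℝ≥0 using hB with b
  refine ⟨C * max 1 (b * C), fun θ r hθ hθ1 hr hrq u g hug => ?_⟩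
  obtain ⟨hsob, himp⟩ := hC u g hug
  have hu : AEStronglyMeasurable u volume := hug.hasWeakGradient.1.aestronglyMeasurable
  set G := eLpNorm g (ENNReal.ofReal p) volume
  have hGtop : G ≠ ⊤ := hug.memLp.2.ne
  have hutop : eLpNorm u (ENNReal.ofReal q) volume ≠ ⊤ :=
    ne_top_of_le_ne_top (ENNReal.mul_ne_top ENNReal.coe_ne_top hGtop) hsob
  have hr0 : 0 < r := by linarith
  rw [mul_div_assoc r]
  set M := morreyNorm r (r * ((N - p) / p)) u with hM
  have hMu : M ≤ b * eLpNorm u (ENNReal.ofReal q) volume := by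
    rw [hBdef]
    exact morreyNorm_le_eLpNorm hr0 hrq.le hαq hu
  have hMG : M ≤ (b * C : ℝ≥0) * G := by
    rw [ENNReal.coe_mul, mul_assoc]
    exact hMu.trans (by gcongr)
  refine ⟨⟨hu, hutop.lt_top⟩, ⟨hu, ?_⟩, ?_⟩
  · exact hMu.trans_lt (ENNReal.mul_lt_top ENNReal.coe_lt_top hutop.lt_top)
  have hθ0 : 0 ≤ p / q := by positivity
  -- The exponent splits as (θ - p/q) + (1 - θ), and M ≤ bCG is spent on the first part.
  have hsplit : M ^ (1 - p / q) ≤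
      (max 1 (b * C) : ℝ≥0) * G ^ (θ - p / q) * M ^ (1 - θ) := by
    calc M ^ (1 - p / q) = M ^ (θ - p / q) * M ^ (1 - θ) := by
          rw [← ENNReal.rpow_add_of_nonneg _ _ (by linarith) (by linarith)]
          congr 1; ring
      _ ≤ ((max 1 (b * C) : ℝ≥0) * G) ^ (θ - p / q) * M ^ (1 - θ) := by
          gcongr
          refine hMG.trans ?_
          gcongr
          exact le_max_right _ _
      _ ≤ _ := by
          rw [ENNReal.mul_rpow_of_nonneg _ _ (by linarith)]
          gcongr
          -- Since θ - p/q ≤ 1 and the base is at least 1, its power is at most the base, which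
          -- removes θ from the constant.
          have hmax : 1 ≤ ((max 1 (b * C) : ℝ≥0) : ℝ≥0∞) := by exact_mod_cast le_max_left _ _
          refine (ENNReal.rpow_le_rpow_of_exponent_le hmax (z := 1) ?_).trans_eq
            (ENNReal.rpow_one _)
          linarith
  calc eLpNorm u (ENNReal.ofReal q) volume
      ≤ C * morreyNorm 1 (1 * ((N - p) / p)) u ^ (1 - p / q) * G ^ (p / q) := himp
    _ ≤ C * M ^ (1 - p / q) * G ^ (p / q) := by
        gcongr
        · linarith
        · exact morreyNorm_mono_exponent one_pos hr hu
    _ ≤ C * ((max 1 (b * C) : ℝ≥0) * G ^ (θ - p / q) * M ^ (1 - θ)) * G ^ (p / q) := by gcongr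
    _ = (C * max 1 (b * C) : ℝ≥0) * (G ^ (θ - p / q) * G ^ (p / q)) * M ^ (1 - θ) := by
        rw [ENNReal.coe_mul C]; ring
    _ = _ := by
        rw [← ENNReal.rpow_add_of_nonneg _ _ (by linarith) hθ0, sub_add_cancel]
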